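/- Let $k\ge 1$ be an integer and let $\mathcal A=\{0,1\}\times\{1,\dots,k\}$ carry the discrete topology. A shift over $\mathcal A$ is a closed set $X\subseteq\mathcal A^{\mathbb Z}$ (product topology) with $\sigma X=X$, where $(\sigma x)(n)=x(n+1)$. For $n\ge 1$ let $P_X(n)$ be the number of words $w=(w_0,\dots,w_{n-1})\in\mathcal A^n$ for which some $x\in X$ satisfies $x(i)=w_i$ for $0\le i<n$. Let $\mathrm{Aut}(X)$ be the group of all homeomorphisms of $X$ onto itself that commute with $\sigma$. A point $x\in X$ is aperiodic if $\sigma^n x\ne x$ for all $n\ge 1$. Then there is a shift $X\subseteq\mathcal A^{\mathbb Z}$ such that 1. the aperiodic points of $X$ are dense in $X$; 2. $P_X(n)=kn+k$ for all $n\ge 1$; 3. $\mathrm{Aut}(X)\cong\mathbb Z^k$. In particular $\limsup_{n\to\infty}P_X(n)/n<k+1$, and $\mathrm{Aut}(X)$ is a finitely generated group of polynomial growth with growth rate exactly $k$: for every finite generating set $S$ of $\mathrm{Aut}(X)$ there are constants $c,C>0$ such that for all $n\ge 1$ the number of elements that are products of at most $n$ elements of $S\cup S^{-1}$ lies between $cn^k$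 and $Cn^k$. Hence the bound $K-1$ for the polynomial growth rate of finitely generated subgroups of $\mathrm{Aut}(X)$, for shifts $X$ with dense aperiodic points and $\limsup_{n\to\infty}P_X(n)/n<K$, is attained for every integer $K\ge 2$ (take $K=k+1$). -/

import Mathlib

namespace ShiftSystem

open SymbolicDynamics.FullShift

/-- The left shift `(σ x) n = x (n + 1)`, as a homeomorphism of the shift `X ⊆ A^ℤ` onto itself. -/
def sigma {A : Type*} [TopologicalSpace A] (X : Subshift A ℤ) : X.carrier ≃ₜ X.carrier where
  toFun x := ⟨shift 1 x.1, X.mapsTo 1 x.2⟩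
  invFun x := ⟨shift (-1) x.1, X.mapsTo (-1) x.2⟩
  left_inv x := by
    apply Subtype.ext
    funext n
    simp [shift]
  right_inv x := by
    apply Subtype.ext
    funext n
    simp [shift]
  continuous_toFun := by
    refine Continuous.subtype_mk ?_ _
    exact (continuous_shift (A := A) (1 : ℤ)).comp continuous_subtype_val
  continuous_invFun := by
    refine Continuous.subtype_mk ?_ _
    exact (continuous_shift (A := A) (-1 : ℤ)).comp continuous_subtype_val

/-- The automorphism group of `X`: the centralizer of the shift in the group of all
homeomorphisms from `X` to itself. -/
abbrev Aut {A : Type*} [TopologicalSpace A] (X : Subshift A ℤ) :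
    Subgroup (X.carrier ≃ₜ X.carrier) :=
  Subgroup.centralizer {sigma X}

/-- The aperiodic points of `X`: those `x` with `σ^n x ≠ x` for every `n ≥ 1`. -/
def aperiodicPoints {A : Type*} [TopologicalSpace A] (X : Subshift A ℤ) : Set X.carrier :=
  {x | x ∉ Function.periodicPts (sigma X)}

/-- The words of length `n` in the language of `X`: those `w = (w 0, …, w (n - 1))` such that
some `x ∈ X` satisfies `x i = w i` for `0 ≤ i < n`. -/
def words {A : Type*} [TopologicalSpace A] (X : Subshift A ℤ) (n : ℕ) : Set (Fin n → A) :=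
  {w | ∃ x ∈ X.carrier, ∀ i : Fin n, x (i : ℤ) = w i}

/-- The complexity function `P_X(n)`, the number of words of length `n` in the language of `X`
(the set of these words is finite as soon as the alphabet is). -/
noncomputable def complexity {A : Type*} [TopologicalSpace A] (X : Subshift A ℤ) (n : ℕ) : ℕ :=
  (words X n).ncard

/-- The ball of radius `n` in the word metric of `S`: the products of at most `n` factors, each
of which is an element of `S` or the inverse of one. -/
def wordBall {G : Type*} [Group G] (S : Set G) (n : ℕ) : Set G :=
  {g | ∃ l : List G, l.length ≤ n ∧ (∀ s ∈ l, s ∈ S ∨ s⁻¹ ∈ S) ∧ l.prod = g}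

/-- `G` is a finitely generated group of polynomial growth with polynomial growth rate exactly
`d`: for each finite generating set, the balls of radius `n` have between `c * n ^ d` and
`C * n ^ d` elements, for some constants `c, C > 0` and all `n ≥ 1`. -/
def HasPolynomialGrowthRate (G : Type*) [Group G] (d : ℕ) : Prop :=
  Group.FG G ∧
    ∀ S : Finset G, Subgroup.closure (S : Set G) = ⊤ →
      ∃ c C : ℝ, 0 < c ∧ 0 < C ∧ ∀ n : ℕ, 1 ≤ n →
        c * (n : ℝ) ^ d ≤ ((wordBall (S : Set G) n).ncard : ℝ) ∧
          ((wordBall (S : Set G) n).ncard : ℝ) ≤ C * (n : ℝ) ^ d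

end ShiftSystem

namespace ShiftSystem

/-! Colour `i` carries one word whose successive ones lie `p = i + 1` apart, except for a single gap
of length `p + 1`. Its words of length `n` are exactly those starting in `[1 - n, 1]`, and these `n
+ 1` words are distinct (`exists_gapSeq_window`, `gapSeq_window_injective`); summing over the
colours gives `k * (n + 1)`.

The `k` orbits are dense and their points are isolated, because `0^p` occurs only in the enlarged
gap. An automorphism preserves isolated points, so it carries orbit `i` to some orbit `j`. Orbit `i`
accumulates on a point of period `i + 1`, which forces `j + 1 ∣ i + 1` (`Aut.succ_dvd_succ`); the
inverse gives the converse, so `i = j`. Hence an automorphism is determined by one translation per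
colour. Every choice of translations occurs, since the colour is constant along each point. The
growth rate then follows by comparing word balls with boxes in `ℤ^k`. -/

/-! ### Combinatorics of the word with one enlarged gap -/

/-- The `0`-`1` sequence with period `p`, taking the value `1` exactly on `1 + p ℤ`. -/
def periodicSeq (p n : ℤ) : Fin 2 := if p ∣ n - 1 then 1 else 0

/-- The bi-infinite word `…10^(p-1) 10^(p-1) 10^p 10^(p-1) 10^(p-1)…`: all the distances between
successive ones are equal to `p`, except one, between the ones at `-p` and `1`. -/
def gapSeq (p n : ℤ) : Fin 2 := if n < 0 ∧ p ∣ n ∨ 0 < n ∧ p ∣ n - 1 then 1 else 0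

theorem gapSeq_zero (p : ℤ) : gapSeq p 0 = 0 := by simp [gapSeq]

theorem gapSeq_eq_zero_iff {p n : ℤ} :
    gapSeq p n = 0 ↔ ¬ (n < 0 ∧ p ∣ n) ∧ ¬ (0 < n ∧ p ∣ n - 1) := by
  unfold gapSeq
  split_ifs with h
  · simp only [one_ne_zero, false_iff]; tauto
  · simp only [true_iff]; tauto

theorem periodicSeq_eq_of_dvd {p m n : ℤ} (h : p ∣ m - n) : periodicSeq p m = periodicSeq p n := by
  unfold periodicSeq
  have : p ∣ m - 1 ↔ p ∣ n - 1 := by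
    rw [show m - 1 = (m - n) + (n - 1) by ring]
    exact dvd_add_right h
  simp only [this]

theorem not_dvd_of_mem_Ioo {p n : ℤ} (h₁ : -p < n) (h₂ : n < 0) : ¬ p ∣ n := by
  intro h
  have := Int.le_of_dvd (by omega : 0 < -n) ((dvd_neg).2 h)
  omega

/-- The bound is sharp: the last one before position `1` is at `1 - p` in the periodic word, but at
`-p` here. -/
theorem gapSeq_eq_periodicSeq {p n : ℤ} (h : 2 - p ≤ n) : gapSeq p n = periodicSeq p n := by
  unfold gapSeq periodicSeq
  rcases lt_trichotomy n 0 with hn | rfl | hn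
  · simp [not_dvd_of_mem_Ioo (show -p < n by omega) hn,
      not_dvd_of_mem_Ioo (show -p < n - 1 by omega) (by omega), hn.not_gt]
  · have := not_dvd_of_mem_Ioo (p := p) (n := -1) (by omega) (by omega)
    simp_all
  · simp [hn, hn.not_gt]

theorem gapSeq_eq_periodicSeq_add_one {p n : ℤ} (h : n < 0) :
    gapSeq p n = periodicSeq p (n + 1) := by
  simp [gapSeq, periodicSeq, h, h.not_gt]

theorem gapSeq_eq_zero {p n : ℤ} (h₁ : -p < n) (h₂ : n ≤ 0) : gapSeq p n = 0 := by
  rw [gapSeq_eq_zero_iff]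
  refine ⟨fun h => not_dvd_of_mem_Ioo h₁ h.1 h.2, fun h => by omega⟩

/-- The word `gapSeq p` differs from its translate by `d ≥ 1` on each interval that contains both
`0` and `1 - d`. -/
theorem not_gapSeq_eq_translate {p d : ℤ} (hd : 0 < d) (h₀ : gapSeq p d = gapSeq p 0)
    (h₁ : gapSeq p (1 - d + d) = gapSeq p (1 - d)) : False := by
  -- Agreement at `0` gives `p ∤ d - 1`, so there is a zero at `1 - d`; agreement there contradicts
  -- the one at `1`.
  rw [gapSeq_zero, gapSeq_eq_zero_iff] at h₀
  have hp : ¬ p ∣ d - 1 := fun h => h₀.2 ⟨hd, h⟩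
  have : gapSeq p (1 - d) = 0 := by
    rw [gapSeq_eq_zero_iff]
    refine ⟨fun h => hp ?_, by omega⟩
    rw [← dvd_neg]
    simpa using h.2
  rw [this, gapSeq_eq_zero_iff] at h₁
  exact h₁.2 (by simp)

theorem exists_dvd_sub_mem {p : ℤ} (hp : 0 < p) (a r : ℤ) :
    ∃ b, a ≤ b ∧ b < a + p ∧ p ∣ b - r := by
  refine ⟨a + (r - a) % p, ?_, ?_, ?_⟩
  · have := Int.emod_nonneg (r - a) hp.ne'; omega
  · have := Int.emod_lt_of_pos (r - a) hp; omega
  · have := Int.emod_add_mul_ediv (r - a) p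
    exact ⟨-((r - a) / p), by linarith⟩

/-- The only occurrence of `0^p` in `gapSeq p` is the one at `[1 - p, 0]`. -/
theorem eq_zero_of_gapSeq_eq_zero {p d : ℤ} (hp : 0 < p)
    (h : ∀ m, 1 - p ≤ m → m ≤ 0 → gapSeq p (d + m) = 0) : d = 0 := by
  by_contra hd
  rcases lt_or_gt_of_ne hd with hd | hd
  · obtain ⟨b, h₁, h₂, h₃⟩ := exists_dvd_sub_mem hp (d + 1 - p) 0
    have := h (b - d) (by omega) (by omega)
    rw [gapSeq_eq_zero_iff, show d + (b - d) = b by ring] at this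
    exact this.1 ⟨by omega, by simpa using h₃⟩
  · obtain ⟨b, h₁, h₂, h₃⟩ := exists_dvd_sub_mem hp (d + 1 - p) 1
    have := h (b - d) (by omega) (by omega)
    rw [gapSeq_eq_zero_iff, show d + (b - d) = b by ring] at this
    refine this.2 ⟨?_, h₃⟩
    by_contra hb
    exact not_dvd_of_mem_Ioo (show -p < b - 1 by omega) (by omega) h₃

/-- The words of length `n` of `gapSeq p` that begin at a position in `[1 - n, 1]` are distinct. -/
theorem gapSeq_window_injective {p n a b : ℤ} (ha : 1 - n ≤ a) (hb : b ≤ 1) (hab : a < b)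
    (h : ∀ m, 0 ≤ m → m < n → gapSeq p (a + m) = gapSeq p (b + m)) : False := by
  refine not_gapSeq_eq_translate (p := p) (d := b - a) (by omega) ?_ ?_
  · have := h (-a) (by omega) (by omega)
    rw [show b - a = b + -a by ring, ← this, add_neg_cancel]
  · have := h (1 - b) (by omega) (by omega)
    rw [show 1 - (b - a) = a + (1 - b) by ring, this]
    congr 1
    ring

/-- Each word of length `n` of `gapSeq p` begins at some position in `[1 - n, 1]`. -/
theorem exists_gapSeq_window {p n : ℤ} (hp : 0 < p) (hn : 0 < n) (a : ℤ) :
    ∃ b, 1 - n ≤ b ∧ b ≤ 1 ∧ ∀ m, 0 ≤ m → m < n → gapSeq p (a + m) = gapSeq p (b + m) := by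
  have key : ∀ c, ∃ b, 1 - n ≤ b ∧ b ≤ 1 ∧
      ∀ m, 0 ≤ m → m < n → periodicSeq p (c + m) = gapSeq p (b + m) := by
    intro c
    obtain ⟨b, h₁, h₂, h₃⟩ := exists_dvd_sub_mem hp (2 - p) c
    have hb : ∀ m, 0 ≤ m → periodicSeq p (c + m) = gapSeq p (b + m) := by
      intro m hm
      rw [gapSeq_eq_periodicSeq (by omega)]
      refine (periodicSeq_eq_of_dvd ?_).symm
      simpa using h₃
    by_cases hbn : 1 - n ≤ b
    · exact ⟨b, hbn, by omega, fun m hm _ => hb m hm⟩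
    -- The window lies wholly inside the enlarged gap, so it reads `0^n`, as does the window ending
    -- at `0`.
    · refine ⟨1 - n, le_rfl, by omega, fun m hm hmn => ?_⟩
      rw [hb m hm, gapSeq_eq_zero (by omega) (by omega), gapSeq_eq_zero (by omega) (by omega)]
  by_cases h₁ : 1 ≤ a
  · obtain ⟨b, hb, hb', h⟩ := key a
    refine ⟨b, hb, hb', fun m hm hmn => ?_⟩
    rw [← h m hm hmn, gapSeq_eq_periodicSeq (by omega)]
  by_cases h₂ : a ≤ -n
  · obtain ⟨b, hb, hb', h⟩ := key (a + 1)
    refine ⟨b, hb, hb', fun m hm hmn => ?_⟩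
    rw [← h m hm hmn, gapSeq_eq_periodicSeq_add_one (by omega)]
    congr 1
    ring
  · exact ⟨a, by omega, by omega, fun _ _ _ => rfl⟩

/-- If `gapSeq q` is eventually constant along some progression of difference `p` whose initial
term is `1`, then `q` divides `p`. -/
theorem dvd_of_eventually_gapSeq_eq {p q : ℤ} (hp : 0 < p) (hq : 0 < q) {c : Fin 2}
    (h : ∀ᶠ t : ℕ in Filter.atTop, gapSeq q (1 + p * t) = c) : q ∣ p := by
  obtain ⟨T, hT⟩ := Filter.eventually_atTop.1 h
  obtain ⟨r, rfl⟩ := Int.eq_ofNat_of_zero_le hq.le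
  -- At `t = r * T` the position is `1` modulo `q`, so the eventual value is `1`; the next term then
  -- yields `q ∣ p`.
  have h₁ := hT (r * T) (Nat.le_mul_of_pos_left T (by omega))
  have h₂ := hT (r * T + 1) ((Nat.le_mul_of_pos_left T (by omega)).trans (Nat.le_succ _))
  have pos : ∀ s : ℕ, 0 < 1 + p * (s : ℤ) := fun s => by positivity
  rw [← h₁] at h₂
  have e : gapSeq (r : ℤ) (1 + p * ((r * T : ℕ) : ℤ)) = 1 := by
    unfold gapSeq
    rw [if_pos]
    refine Or.inr ⟨pos _, ⟨p * T, ?_⟩⟩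
    push_cast; ring
  rw [e] at h₂
  unfold gapSeq at h₂
  split_ifs at h₂ with h₃
  · rcases h₃ with h₃ | h₃
    · exact absurd h₃.1 (pos _).le.not_gt
    · have := h₃.2
      rw [show 1 + p * ((r * T + 1 : ℕ) : ℤ) - 1 = r * (p * T) + p by push_cast; ring] at this
      exact (dvd_add_right (Dvd.intro _ rfl)).1 this
  · simp at h₂


/-! ### Balls in the word metric -/

section WordBall

variable {G : Type*} [Group G] {S : Set G}

theorem one_mem_wordBall (n : ℕ) : (1 : G) ∈ wordBall S n := ⟨[], by simp⟩

theorem wordBall_mono {m n : ℕ} (h : m ≤ n) : wordBall S m ⊆ wordBall S n := by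
  rintro g ⟨l, hl, hS, rfl⟩
  exact ⟨l, hl.trans h, hS, rfl⟩

theorem mul_mem_wordBall {m n : ℕ} {g h : G} (hg : g ∈ wordBall S m) (hh : h ∈ wordBall S n) :
    g * h ∈ wordBall S (m + n) := by
  obtain ⟨l, hl, hS, rfl⟩ := hg
  obtain ⟨l', hl', hS', rfl⟩ := hh
  refine ⟨l ++ l', by simp; omega, fun s hs => ?_, List.prod_append⟩
  rcases List.mem_append.1 hs with hs | hs
  exacts [hS s hs, hS' s hs]

theorem pow_mem_wordBall {m : ℕ} {g : G} (hg : g ∈ wordBall S m) (n : ℕ) :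
    g ^ n ∈ wordBall S (n * m) := by
  induction n with
  | zero => simpa using one_mem_wordBall 0
  | succ n ih =>
    rw [pow_succ, add_mul, one_mul]
    exact mul_mem_wordBall ih hg

theorem exists_mem_wordBall (hS : Subgroup.closure S = ⊤) (g : G) : ∃ n, g ∈ wordBall S n := by
  have hg : g ∈ (Subgroup.closure S).toSubmonoid := by simp [hS]
  rw [Subgroup.closure_toSubmonoid] at hg
  obtain ⟨l, hl, h⟩ := Submonoid.exists_list_of_mem_closure hg
  exact ⟨l.length, l, le_rfl, hl, h⟩

theorem list_prod_mem_wordBall {m : ℕ} (l : List G) (h : ∀ g ∈ l, g ∈ wordBall S m) :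
    l.prod ∈ wordBall S (l.length * m) := by
  induction l with
  | nil => simpa using one_mem_wordBall 0
  | cons g l ih =>
    rw [List.prod_cons, List.length_cons, add_mul, one_mul, add_comm]
    exact mul_mem_wordBall (h g (by simp)) (ih fun g' hg' => h g' (by simp [hg']))

end WordBall

/-! ### Polynomial growth of groups isomorphic to `ℤ^k` -/

section Growth

variable {k : ℕ} {G : Type*} [Group G] (e : G ≃* Multiplicative (Fin k → ℤ))
include e

theorem abs_coord_le_of_mem_wordBall {S : Set G} {M : ℤ}
    (hM : ∀ s ∈ S, ∀ i, |(e s).toAdd i| ≤ M) (i : Fin k) (l : List G)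
    (hl : ∀ s ∈ l, s ∈ S ∨ s⁻¹ ∈ S) : |(e l.prod).toAdd i| ≤ l.length * M := by
  induction l with
  | nil => simp
  | cons g l ih =>
    have hg : |(e g).toAdd i| ≤ M := by
      rcases hl g (by simp) with h | h
      · exact hM g h i
      · simpa using hM _ h i
    have := ih fun s hs => hl s (by simp [hs])
    rw [List.prod_cons, map_mul, toAdd_mul, Pi.add_apply, List.length_cons]
    push_cast
    rw [add_mul, one_mul]
    exact (abs_add_le _ _).trans (by linarith)

theorem exists_wordBall_subset (S : Finset G) :
    ∃ M : ℕ, 1 ≤ M ∧ ∀ n : ℕ, wordBall (S : Set G) n ⊆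
      (fun v : Fin k → ℤ => e.symm (Multiplicative.ofAdd v)) ''
        (Finset.Icc (fun _ => -((n * M : ℕ) : ℤ)) fun _ => ((n * M : ℕ) : ℤ) :
          Finset (Fin k → ℤ)) := by
  refine ⟨1 + ∑ s ∈ S, ∑ i, ((e s).toAdd i).natAbs, by omega, fun n => ?_⟩
  rintro g ⟨l, hl, hS, rfl⟩
  refine ⟨(e l.prod).toAdd, ?_, by simp⟩
  set M := 1 + ∑ s ∈ S, ∑ i, ((e s).toAdd i).natAbs with hMdef
  have hM : ∀ s ∈ (S : Set G), ∀ i, |(e s).toAdd i| ≤ (M : ℤ) := by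
    intro s hs i
    have h₁ : ((e s).toAdd i).natAbs ≤ ∑ i, ((e s).toAdd i).natAbs :=
      Finset.single_le_sum (f := fun i => ((e s).toAdd i).natAbs) (by simp) (Finset.mem_univ i)
    have h₂ : ∑ i, ((e s).toAdd i).natAbs ≤ ∑ s ∈ S, ∑ i, ((e s).toAdd i).natAbs :=
      Finset.single_le_sum (f := fun s => ∑ i, ((e s).toAdd i).natAbs) (by simp) hs
    rw [Int.abs_eq_natAbs]
    omega
  have h : ∀ i, |(e l.prod).toAdd i| ≤ ((n * M : ℕ) : ℤ) := by
    intro i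
    refine (abs_coord_le_of_mem_wordBall e hM i l hS).trans ?_
    push_cast
    gcongr
  simp only [Finset.coe_Icc, Set.mem_Icc, Pi.le_def]
  exact ⟨fun i => (abs_le.1 (h i)).1, fun i => (abs_le.1 (h i)).2⟩

theorem exists_subset_wordBall {S : Set G} (hS : Subgroup.closure S = ⊤) :
    ∃ L : ℕ, 1 ≤ L ∧ ∀ m : ℕ,
      (fun v : Fin k → ℕ => e.symm (Multiplicative.ofAdd fun i => (v i : ℤ))) ''
        (Finset.Icc 0 fun _ => m : Finset (Fin k → ℕ)) ⊆ wordBall S (m * L) := by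
  have : ∀ i : Fin k, ∃ n, e.symm (Multiplicative.ofAdd (Pi.single i 1)) ∈ wordBall S n :=
    fun i => exists_mem_wordBall hS _
  choose N hN using this
  -- Each of the `k` powers of basis vectors costs at most `m * (1 + ∑ i, N i)`; the final `+ 1`
  -- keeps `L` positive when `k = 0`.
  refine ⟨k * (1 + ∑ i, N i) + 1, by omega, fun m => ?_⟩
  rintro _ ⟨v, hv, rfl⟩
  simp only [Finset.coe_Icc, Set.mem_Icc, Pi.le_def] at hv
  have hprod : e.symm (Multiplicative.ofAdd fun i => (v i : ℤ)) =
      (List.ofFn fun i => e.symm (Multiplicative.ofAdd (Pi.single i 1)) ^ v i).prod := by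
    apply e.injective
    rw [map_list_prod, List.map_ofFn, List.prod_ofFn, MulEquiv.apply_symm_apply]
    apply Multiplicative.toAdd.injective
    rw [toAdd_prod]
    ext j
    simp [Pi.single_apply]
  show e.symm _ ∈ _
  rw [hprod]
  have := list_prod_mem_wordBall (S := S) (m := m * (1 + ∑ i, N i))
    (List.ofFn fun i => e.symm (Multiplicative.ofAdd (Pi.single i 1)) ^ v i) (by
      intro g hg
      obtain ⟨i, rfl⟩ := List.mem_ofFn.1 hg
      refine wordBall_mono ?_ (pow_mem_wordBall (hN i) (v i))
      have : N i ≤ ∑ i, N i := Finset.single_le_sum (f := N) (by simp) (Finset.mem_univ i)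
      exact Nat.mul_le_mul (hv.2 i) (by omega))
  refine wordBall_mono ?_ this
  rw [List.length_ofFn]
  nlinarith

theorem hasPolynomialGrowthRate_of_mulEquiv : HasPolynomialGrowthRate G k := by
  refine ⟨?_, fun S hS => ?_⟩
  · exact Group.fg_of_surjective (f := e.symm.toMonoidHom) e.symm.surjective
  obtain ⟨M, hM, hsub⟩ := exists_wordBall_subset e S
  obtain ⟨L, hL, hsup⟩ := exists_subset_wordBall e hS
  -- The lower constant uses `n / L < ⌊n / L⌋ + 1`, the upper one `2 * n * M + 1 ≤ 3 * n * M`.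
  refine ⟨(1 / L : ℝ) ^ k, (3 * M : ℝ) ^ k, by positivity, by positivity, fun n hn => ⟨?_, ?_⟩⟩
  · have hfin : (wordBall (S : Set G) n).Finite := ((Finset.finite_toSet _).image _).subset (hsub n)
    have h₁ := Set.ncard_le_ncard ((hsup (n / L)).trans (wordBall_mono (Nat.div_mul_le_self n L)))
      hfin
    rw [Set.ncard_image_of_injective, Set.ncard_coe_finset, Pi.card_Icc] at h₁
    · simp only [Pi.zero_apply, Nat.card_Icc, Finset.prod_const, Finset.card_univ,
        Fintype.card_fin, tsub_zero] at h₁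
      have h₂ : (((n / L + 1) ^ k : ℕ) : ℝ) ≤ ((wordBall (S : Set G) n).ncard : ℝ) :=
        Nat.cast_le.2 h₁
      refine le_trans ?_ h₂
      rw [← mul_pow]
      push_cast
      gcongr
      rw [one_div, inv_mul_eq_div]
      have := Nat.lt_floor_add_one ((n : ℝ) / L)
      rw [Nat.floor_div_eq_div] at this
      exact this.le
    · intro v w hvw
      have := e.symm.injective hvw
      ext i
      exact_mod_cast congrFun (Multiplicative.ofAdd.injective this) i
  · have h₁ := (Set.ncard_le_ncard (hsub n) ((Finset.finite_toSet _).image _))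
    have h₂ := h₁.trans (Set.ncard_image_le (Finset.finite_toSet _))
    rw [Set.ncard_coe_finset, Pi.card_Icc] at h₂
    simp only [Int.card_Icc, Finset.prod_const, Finset.card_univ, Fintype.card_fin] at h₂
    have h₃ : (((n * M : ℕ) : ℤ) + 1 - -((n * M : ℕ) : ℤ)).toNat ≤ 3 * M * n := by
      have : 1 ≤ n * M := Nat.mul_pos hn hM
      rw [show 3 * M * n = 3 * (n * M) by ring]
      omega
    have h₄ := h₂.trans (Nat.pow_le_pow_left h₃ k)
    rw [← mul_pow]
    exact_mod_cast h₄

end Growth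


/-! ### The coloured shift -/

open SymbolicDynamics.FullShift Filter Topology

theorem shift_shift {A : Type*} (a b : ℤ) (x : ℤ → A) : shift a (shift b x) = shift (a + b) x := by
  rw [add_comm, shift_add]

variable {k : ℕ}

/-- The word with one enlarged gap and period `i + 1` elsewhere, coloured by `i`. -/
def colorSeq (i : Fin k) (n : ℤ) : Fin 2 × Fin k := (gapSeq (i + 1) n, i)

/-- The union of the orbits of the words `colorSeq i`. -/
def colorOrbits (k : ℕ) : Set (ℤ → Fin 2 × Fin k) := {x | ∃ i a, x = shift a (colorSeq i)}

/-- The shift whose points are the limits of translates of the words `colorSeq i`, `i : Fin k`. -/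
def gapShift (k : ℕ) : Subshift (Fin 2 × Fin k) ℤ where
  carrier := closure (colorOrbits k)
  isClosed := isClosed_closure
  mapsTo a := by
    refine Set.MapsTo.closure ?_ (continuous_shift a)
    rintro _ ⟨i, b, rfl⟩
    exact ⟨i, a + b, shift_shift a b _⟩

theorem shift_colorSeq_apply (i : Fin k) (a n : ℤ) :
    shift a (colorSeq i) n = (gapSeq (i + 1) (a + n), i) := rfl

theorem shift_colorSeq_mem (i : Fin k) (a : ℤ) : shift a (colorSeq i) ∈ (gapShift k).carrier :=
  subset_closure ⟨i, a, rfl⟩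

theorem shift_colorSeq_injective (i : Fin k) :
    Function.Injective fun a : ℤ => shift a (colorSeq i) := by
  have key : ∀ a b : ℤ, a < b → shift a (colorSeq i) = shift b (colorSeq i) → False := by
    intro a b hab h
    have h' : ∀ n, gapSeq (i + 1) n = gapSeq (i + 1) (n + (b - a)) := by
      intro n
      have := congrArg Prod.fst (congrFun h (n - a))
      simp only [shift_colorSeq_apply] at this
      rw [show a + (n - a) = n by ring] at this
      rw [this]
      congr 1
      ring
    refine not_gapSeq_eq_translate (p := i + 1) (d := b - a) (by omega) ?_ (h' _).symm
    rw [h' 0, zero_add]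
  intro a b h
  rcases lt_trichotomy a b with hab | hab | hab
  exacts [(key a b hab h).elim, hab, (key b a hab h.symm).elim]

theorem snd_eq_of_mem_gapShift {x : ℤ → Fin 2 × Fin k} (hx : x ∈ (gapShift k).carrier) (m n : ℤ) :
    (x m).2 = (x n).2 := by
  have hcl : IsClosed {y : ℤ → Fin 2 × Fin k | (y m).2 = (y n).2} :=
    isClosed_eq (by fun_prop) (by fun_prop)
  refine closure_minimal ?_ hcl hx
  rintro _ ⟨i, a, rfl⟩
  rfl

/-! ### Complexity -/

/-- Cylinders are open, so taking the closure of the orbits creates no new finite words. -/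
theorem words_gapShift (n : ℕ) (w : Fin n → Fin 2 × Fin k) :
    w ∈ words (gapShift k) n ↔ ∃ i a, ∀ m : Fin n, w m = shift a (colorSeq i) m := by
  constructor
  · rintro ⟨x, hx, hw⟩
    have ho : IsOpen (cylinder ((Finset.range n).image fun m : ℕ => (m : ℤ)) x) :=
      isOpen_cylinder _ _
    obtain ⟨_, hy, i, a, rfl⟩ := mem_closure_iff.1 hx _ ho fun _ _ => rfl
    refine ⟨i, a, fun m => ?_⟩
    rw [← hw m]
    exact (hy m (by simp)).symm
  · rintro ⟨i, a, hw⟩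
    exact ⟨_, shift_colorSeq_mem i a, fun m => (hw m).symm⟩

theorem complexity_gapShift {n : ℕ} (hn : 1 ≤ n) : complexity (gapShift k) n = k * n + k := by
  have himage : words (gapShift k) n =
      (fun (q : Fin k × ℤ) (m : Fin n) => shift q.2 (colorSeq q.1) m) ''
        ((Finset.univ ×ˢ Finset.Icc (1 - n : ℤ) 1 : Finset (Fin k × ℤ)) : Set (Fin k × ℤ)) := by
    ext w
    rw [words_gapShift]
    constructor
    · rintro ⟨i, a, hw⟩
      obtain ⟨b, h₁, h₂, hb⟩ := exists_gapSeq_window (p := i + 1) (n := n) (by omega) (by omega) a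
      refine ⟨(i, b), by simp [h₁, h₂], funext fun m => ?_⟩
      rw [hw]
      simp only [shift_colorSeq_apply]
      rw [hb m (by omega) (by omega)]
    · rintro ⟨⟨i, a⟩, -, rfl⟩
      exact ⟨i, a, fun _ => rfl⟩
  have hinj : Set.InjOn (fun (q : Fin k × ℤ) (m : Fin n) => shift q.2 (colorSeq q.1) m)
      ((Finset.univ ×ˢ Finset.Icc (1 - n : ℤ) 1 : Finset (Fin k × ℤ)) : Set (Fin k × ℤ)) := by
    rintro ⟨i, a⟩ ha ⟨j, b⟩ hb h
    simp only [Finset.coe_product, Set.mem_prod, Finset.coe_Icc, Set.mem_Icc] at ha hb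
    obtain rfl : i = j := congrArg Prod.snd (congrFun h ⟨0, hn⟩)
    have h' : ∀ m : ℤ, 0 ≤ m → m < n → gapSeq (i + 1) (a + m) = gapSeq (i + 1) (b + m) := by
      intro m hm hmn
      obtain ⟨m, rfl⟩ := Int.eq_ofNat_of_zero_le hm
      exact congrArg Prod.fst (congrFun h ⟨m, by exact_mod_cast hmn⟩)
    rcases lt_trichotomy a b with hab | rfl | hab
    · exact (gapSeq_window_injective ha.2.1 hb.2.2 hab h').elim
    · rfl
    · exact (gapSeq_window_injective hb.2.1 ha.2.2 hab fun m h₁ h₂ => (h' m h₁ h₂).symm).elim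
  rw [complexity, himage, hinj.ncard_image, Set.ncard_coe_finset,
    Finset.card_product, Finset.card_univ, Fintype.card_fin, Int.card_Icc, ← mul_add_one]
  congr 1
  omega

/-! ### The dense orbits -/

/-- The points `shift a (colorSeq i)` of `gapShift k`. -/
def orbitPoint (i : Fin k) (a : ℤ) : (gapShift k).carrier :=
  ⟨shift a (colorSeq i), shift_colorSeq_mem i a⟩

theorem orbitPoint_injective (i : Fin k) : Function.Injective (orbitPoint i) :=
  fun _ _ h => shift_colorSeq_injective i (congrArg Subtype.val h)

theorem iterate_sigma_apply {A : Type*} [TopologicalSpace A] {X : Subshift A ℤ} (x : X.carrier)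
    (n : ℕ) : ((sigma X)^[n] x).1 = shift (n : ℤ) x.1 := by
  induction n with
  | zero => simp
  | succ n ih =>
    rw [Function.iterate_succ_apply']
    show shift 1 ((sigma X)^[n] x).1 = _
    rw [ih, shift_shift]
    congr 1
    push_cast
    ring

theorem iterate_sigma_orbitPoint (i : Fin k) (a : ℤ) (n : ℕ) :
    (sigma (gapShift k))^[n] (orbitPoint i a) = orbitPoint i (n + a) := by
  apply Subtype.ext
  rw [iterate_sigma_apply]
  exact shift_shift n a (colorSeq i)

theorem orbitPoint_mem_aperiodicPoints (i : Fin k) (a : ℤ) :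
    orbitPoint i a ∈ aperiodicPoints (gapShift k) := by
  rintro ⟨n, hn, h⟩
  rw [Function.IsPeriodicPt, Function.IsFixedPt, iterate_sigma_orbitPoint] at h
  have := orbitPoint_injective i h
  omega

theorem dense_orbitPoint (k : ℕ) : Dense {x | ∃ (i : Fin k) (a : ℤ), x = orbitPoint i a} := by
  rw [Subtype.dense_iff]
  refine closure_mono ?_
  rintro _ ⟨i, a, rfl⟩
  exact ⟨orbitPoint i a, ⟨i, a, rfl⟩, rfl⟩

theorem dense_aperiodicPoints_gapShift (k : ℕ) : Dense (aperiodicPoints (gapShift k)) := by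
  refine (dense_orbitPoint k).mono ?_
  rintro _ ⟨i, a, rfl⟩
  exact orbitPoint_mem_aperiodicPoints i a

/-- The cylinder of the block `0^(i + 1)` in colour `i` meets the dense orbits in one point only.
Removing that point leaves an open set missing a dense set, hence nothing. -/
theorem isOpen_singleton_orbitPoint (i : Fin k) :
    IsOpen ({orbitPoint i 0} : Set (gapShift k).carrier) := by
  have ho : IsOpen (Subtype.val ⁻¹' cylinder (Finset.Icc (-i : ℤ) 0) (colorSeq i) :
      Set (gapShift k).carrier) := (isOpen_cylinder _ _).preimage continuous_subtype_val
  have hsub : ∀ x ∈ (Subtype.val ⁻¹' cylinder (Finset.Icc (-i : ℤ) 0) (colorSeq i) :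
      Set (gapShift k).carrier), x ∈ {x | ∃ (i : Fin k) (a : ℤ), x = orbitPoint i a} →
      x = orbitPoint i 0 := by
    rintro _ h ⟨j, a, rfl⟩
    have h' : ∀ m : ℤ, -i ≤ m → m ≤ 0 → (gapSeq (j + 1) (a + m), j) = (gapSeq (i + 1) m, i) :=
      fun m h₁ h₂ => h m (by simp [h₁, h₂])
    obtain rfl : j = i := congrArg Prod.snd (h' 0 (by omega) le_rfl)
    congr 1
    refine eq_zero_of_gapSeq_eq_zero (p := j + 1) (by omega) fun m h₁ h₂ => ?_
    have := congrArg Prod.fst (h' m (by omega) h₂)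
    simp only at this
    rw [this, gapSeq_eq_zero (by omega) h₂]
  convert ho using 1
  refine Set.Subset.antisymm ?_ ?_
  · rintro _ rfl m -
    show shift 0 (colorSeq i) m = _
    rw [shift_zero]
  · intro x hx
    by_contra hne
    obtain ⟨y, ⟨hy, hyne⟩, hyo⟩ := (dense_orbitPoint k).inter_open_nonempty _
      (ho.inter (isOpen_compl_singleton (x := orbitPoint i 0))) ⟨x, hx, hne⟩
    exact hyne (hsub y hy hyo)

/-! ### Automorphisms -/

theorem Aut.apply_iterate_sigma {A : Type*} [TopologicalSpace A] {X : Subshift A ℤ} (φ : Aut X)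
    (n : ℕ) (x : X.carrier) : φ.1 ((sigma X)^[n] x) = (sigma X)^[n] (φ.1 x) := by
  have : ∀ y, φ.1 (sigma X y) = sigma X (φ.1 y) := fun y =>
    (DFunLike.congr_fun (Subgroup.mem_centralizer_iff.1 φ.2 _ rfl) y).symm
  exact (Function.Semiconj.iterate_right (show Function.Semiconj φ.1 _ _ from this) n) x

theorem Aut.apply_orbitPoint {φ : Aut (gapShift k)} {i j : Fin k} {a : ℤ}
    (h : φ.1 (orbitPoint i 0) = orbitPoint j a) (b : ℤ) :
    φ.1 (orbitPoint i b) = orbitPoint j (b + a) := by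
  -- Commutation is known for nonnegative iterates, so a negative `b` is first pushed to `n ≥ 0` and
  -- `m` shifts are cancelled afterwards.
  obtain ⟨m, n, hmn⟩ : ∃ m n : ℕ, (m : ℤ) + b = n := ⟨b.natAbs, (b.natAbs + b).toNat, by omega⟩
  apply ((sigma (gapShift k)).injective.iterate m)
  rw [← Aut.apply_iterate_sigma, iterate_sigma_orbitPoint, iterate_sigma_orbitPoint, ← add_assoc,
    hmn, ← iterate_sigma_orbitPoint, ← h, ← Aut.apply_iterate_sigma, iterate_sigma_orbitPoint,
    add_zero]

/-- The image of an isolated point is isolated, and a dense set contains every isolated point. -/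
theorem Aut.exists_apply_eq_orbitPoint (φ : Aut (gapShift k)) (i : Fin k) :
    ∃ j a, φ.1 (orbitPoint i 0) = orbitPoint j a := by
  have ho := φ.1.isOpenMap _ (isOpen_singleton_orbitPoint i)
  rw [Set.image_singleton] at ho
  obtain ⟨_, rfl, h⟩ := (dense_orbitPoint k).inter_open_nonempty _ ho (Set.singleton_nonempty _)
  exact h

/-- The translates of `colorSeq i` by multiples of `i + 1` converge. -/
theorem exists_tendsto_orbitPoint (i : Fin k) :
    ∃ x, Tendsto (fun t : ℕ => orbitPoint i (((i + 1) * t : ℕ) : ℤ)) atTop (𝓝 x) := by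
  have h : Tendsto (fun t : ℕ => (orbitPoint i (((i + 1) * t : ℕ) : ℤ)).1) atTop
      (𝓝 fun n => (periodicSeq (i + 1) n, i)) := by
    refine tendsto_pi_nhds.2 fun n => tendsto_nhds_of_eventually_eq ?_
    filter_upwards [eventually_ge_atTop (n.natAbs + 1)] with t ht
    have : t ≤ (i + 1) * t := Nat.le_mul_of_pos_left t (by omega)
    show (gapSeq (i + 1) _, i) = _
    rw [gapSeq_eq_periodicSeq (by omega), periodicSeq_eq_of_dvd]
    exact ⟨t, by push_cast; ring⟩
  exact ⟨⟨_, (gapShift k).isClosed.mem_of_tendsto h (Eventually.of_forall fun t => Subtype.prop _)⟩,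
    tendsto_subtype_rng.2 h⟩

theorem Aut.succ_dvd_succ {φ : Aut (gapShift k)} {i j : Fin k} {a : ℤ}
    (h : φ.1 (orbitPoint i 0) = orbitPoint j a) : ((j : ℤ) + 1) ∣ (i : ℤ) + 1 := by
  obtain ⟨x, hx⟩ := exists_tendsto_orbitPoint i
  have h₁ := ((φ.1.continuous.tendsto x).comp hx)
  -- Coordinate `1 - a` of the images reads `gapSeq (j + 1)` along `1 + (i + 1) * t`; convergence
  -- makes it eventually constant.
  have h₃ := (tendsto_pi_nhds.1 (tendsto_subtype_rng.1 h₁)) (1 - a)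
  rw [nhds_discrete, tendsto_pure] at h₃
  refine dvd_of_eventually_gapSeq_eq (by omega) (by omega) (c := ((φ.1 x).1 (1 - a)).1) ?_
  filter_upwards [h₃] with t ht
  rw [Function.comp_apply, Aut.apply_orbitPoint h] at ht
  rw [← ht]
  show _ = gapSeq _ _
  congr 1
  push_cast
  ring

theorem Aut.exists_apply_eq (φ : Aut (gapShift k)) (i : Fin k) :
    ∃ a, φ.1 (orbitPoint i 0) = orbitPoint i a := by
  obtain ⟨j, a, h⟩ := Aut.exists_apply_eq_orbitPoint φ i
  obtain ⟨i', b, h'⟩ := Aut.exists_apply_eq_orbitPoint φ⁻¹ j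
  have hi : orbitPoint i 0 = orbitPoint i' (a + b) := by
    rw [← Aut.apply_orbitPoint h' a, ← h]
    exact (φ.1.symm_apply_apply _).symm
  obtain rfl : i = i' := congrArg Prod.snd (congrFun (congrArg Subtype.val hi) 0)
  have h₁ := Int.le_of_dvd (by omega) (Aut.succ_dvd_succ h)
  have h₂ := Int.le_of_dvd (by omega) (Aut.succ_dvd_succ h')
  obtain rfl : i = j := by omega
  exact ⟨a, h⟩

/-- Translation by `a i` on the points of colour `i`. -/
def colorShiftFun (a : Fin k → ℤ) (x : (gapShift k).carrier) : (gapShift k).carrier :=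
  ⟨shift (a (x.1 0).2) x.1, (gapShift k).mapsTo _ x.2⟩

theorem colorShiftFun_add (a b : Fin k → ℤ) (x : (gapShift k).carrier) :
    colorShiftFun a (colorShiftFun b x) = colorShiftFun (a + b) x := by
  apply Subtype.ext
  show shift (a (x.1 _).2) (shift (b (x.1 0).2) x.1) = shift (a (x.1 0).2 + b (x.1 0).2) x.1
  rw [shift_shift, snd_eq_of_mem_gapShift x.2 _ 0]

theorem colorShiftFun_zero (x : (gapShift k).carrier) : colorShiftFun 0 x = x :=
  Subtype.ext (shift_zero _)

/-- The colour is locally constant, so the map is locally a fixed shift. -/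
theorem continuous_colorShiftFun (a : Fin k → ℤ) : Continuous (colorShiftFun a) := by
  refine Continuous.subtype_mk (continuous_pi fun n => ?_) _
  refine continuous_iff_continuousAt.2 fun x => ?_
  have hc : Continuous fun y : (gapShift k).carrier => (y.1 0).2 :=
    continuous_snd.comp ((continuous_apply 0).comp continuous_subtype_val)
  have h : ∀ᶠ y : (gapShift k).carrier in 𝓝 x, (y.1 0).2 = (x.1 0).2 :=
    hc.continuousAt.eventually_mem ((isOpen_discrete {(x.1 0).2}).mem_nhds rfl)
  have h' : ContinuousAt (fun y : (gapShift k).carrier => y.1 (a (x.1 0).2 + n)) x :=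
    ((continuous_apply _).comp continuous_subtype_val).continuousAt
  refine h'.congr ?_
  filter_upwards [h] with y hy
  show _ = y.1 (a (y.1 0).2 + n)
  rw [hy]

/-- `colorShiftFun a` as a homeomorphism. -/
def colorShift (a : Fin k → ℤ) : (gapShift k).carrier ≃ₜ (gapShift k).carrier where
  toFun := colorShiftFun a
  invFun := colorShiftFun (-a)
  left_inv x := by rw [colorShiftFun_add, neg_add_cancel, colorShiftFun_zero]
  right_inv x := by rw [colorShiftFun_add, add_neg_cancel, colorShiftFun_zero]
  continuous_toFun := continuous_colorShiftFun a
  continuous_invFun := continuous_colorShiftFun (-a)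

theorem sigma_eq_colorShift (k : ℕ) : sigma (gapShift k) = colorShift 1 :=
  Homeomorph.ext fun _ => rfl

theorem colorShift_mul (a b : Fin k → ℤ) : colorShift a * colorShift b = colorShift (a + b) :=
  Homeomorph.ext fun x => colorShiftFun_add a b x

theorem colorShift_orbitPoint (a : Fin k → ℤ) (i : Fin k) (b : ℤ) :
    colorShift a (orbitPoint i b) = orbitPoint i (a i + b) :=
  Subtype.ext (shift_shift (a i) b (colorSeq i))

/-- The action of `ℤ^k` on `gapShift k` by automorphisms. -/
def colorShiftHom (k : ℕ) : Multiplicative (Fin k → ℤ) →* Aut (gapShift k) where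
  toFun a := ⟨colorShift a.toAdd, by
    rw [Subgroup.mem_centralizer_singleton_iff, sigma_eq_colorShift, colorShift_mul,
      colorShift_mul, add_comm]⟩
  map_one' := Subtype.ext (Homeomorph.ext colorShiftFun_zero)
  map_mul' a b := Subtype.ext (colorShift_mul a.toAdd b.toAdd).symm

theorem colorShiftHom_injective (k : ℕ) : Function.Injective (colorShiftHom k) := by
  intro a b h
  apply Multiplicative.toAdd.injective
  ext i
  have := DFunLike.congr_fun (congrArg Subtype.val h) (orbitPoint i 0)
  change colorShift a.toAdd _ = colorShift b.toAdd _ at this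
  rw [colorShift_orbitPoint, colorShift_orbitPoint] at this
  exact add_right_cancel (orbitPoint_injective i this)

theorem colorShiftHom_surjective (k : ℕ) : Function.Surjective (colorShiftHom k) := by
  intro φ
  choose a ha using Aut.exists_apply_eq φ
  refine ⟨Multiplicative.ofAdd a, Subtype.ext (Homeomorph.ext fun x => ?_)⟩
  -- Two continuous maps agreeing on the dense orbits coincide.
  refine congrFun (Continuous.ext_on (dense_orbitPoint k) (colorShift a).continuous
    φ.1.continuous ?_) x
  rintro _ ⟨i, b, rfl⟩
  rw [colorShift_orbitPoint, Aut.apply_orbitPoint (ha i), add_comm]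

/-- The automorphism group of `gapShift k` is `ℤ^k`. -/
noncomputable def autGapShiftEquiv (k : ℕ) : Aut (gapShift k) ≃* Multiplicative (Fin k → ℤ) :=
  (MulEquiv.ofBijective (colorShiftHom k)
    ⟨colorShiftHom_injective k, colorShiftHom_surjective k⟩).symm

/-! ### Asymptotic complexity -/

theorem limsup_complexity_gapShift_lt (k : ℕ) :
    limsup (fun n : ℕ => (((complexity (gapShift k) n : ℝ) / (n : ℝ) : ℝ) : EReal)) atTop <
      ((k + 1 : ℕ) : EReal) := by
  have h : Tendsto (fun n : ℕ => (complexity (gapShift k) n : ℝ) / (n : ℝ)) atTop (𝓝 k) := by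
    have h₀ : Tendsto (fun n : ℕ => (k : ℝ) + k / (n : ℝ)) atTop (𝓝 (k + 0)) :=
      tendsto_const_nhds.add (tendsto_const_div_atTop_nhds_zero_nat _)
    rw [add_zero] at h₀
    refine h₀.congr' ?_
    filter_upwards [eventually_ge_atTop 1] with n hn
    rw [complexity_gapShift hn]
    have : (n : ℝ) ≠ 0 := by positivity
    push_cast
    field_simp
  refine ((continuous_coe_real_ereal.tendsto _).comp h).limsup_eq.trans_lt ?_
  exact_mod_cast Nat.lt_succ_self k

end ShiftSystem

theorem mainTheorem8 (k : ℕ) (hk : 1 ≤ k) :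
    ∃ X : SymbolicDynamics.FullShift.Subshift (Fin 2 × Fin k) ℤ,
      Dense (ShiftSystem.aperiodicPoints X) ∧
      (∀ n : ℕ, 1 ≤ n → ShiftSystem.complexity X n = k * n + k) ∧
      Nonempty (ShiftSystem.Aut X ≃* Multiplicative (Fin k → ℤ)) ∧
      -- the bound "growth rate at most `K - 1` if `limsup P_X(n) / n < K`" is attained at `K = k + 1`
      Filter.limsup (fun n : ℕ => (((ShiftSystem.complexity X n : ℝ) / (n : ℝ) : ℝ) : EReal))
        Filter.atTop < ((k + 1 : ℕ) : EReal) ∧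
      ShiftSystem.HasPolynomialGrowthRate (ShiftSystem.Aut X) k :=
  ⟨ShiftSystem.gapShift k, ShiftSystem.dense_aperiodicPoints_gapShift k,
    fun _ hn => ShiftSystem.complexity_gapShift hn, ⟨ShiftSystem.autGapShiftEquiv k⟩,
    ShiftSystem.limsup_complexity_gapShift_lt k,
    ShiftSystem.hasPolynomialGrowthRate_of_mulEquiv (ShiftSystem.autGapShiftEquiv k)⟩
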